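/- Let $q$ be a prime power with $q\neq 2$ and $q\neq 4$. A degenerate Hermitian curve (of rank $2$) of ${\rm PG}(2,q^2)$ is a cone with vertex a point $V$ and base a Baer subline $B$ of a line not through $V$, that is, the union of the $q+1$ lines joining $V$ to the points of $B$; here a Baer subline is a set of the form $\{\langle au+bw\rangle : (a,b)\in {\rm GF}(q)^2\setminus\{(0,0)\}\}$ with $u,w\in {\rm GF}(q^2)^3$ linearly independent over ${\rm GF}(q^2)$. For $x\in{\rm GF}(q)$ and $\xi\in{\rm GF}(q^2)$ let $$\mathcal P_{x,\xi}=\{(1,0,0),(0,1,0),(0,0,1),(1,1,1)\}\cup\{(1,x,\xi x),(\xi x,1,x),(x,\xi x,1)\},$$ a set of points of ${\rm PG}(2,q^2)$ given by homogeneous coordinates. Then there exist $x\in{\rm GF}(q)\setminus\{0,1\}$ and $\xi\in{\rm GF}(q^2)\setminus{\rm GF}(q)$ such that $\mathcal P_{x,\xi}$ consists of exactly seven points and no degenerate Hermitian curve of ${\rm PG}(2,q^2)$ contains $\mathcal P_{x,\xi}$. -/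

import Mathlib

open scoped LinearAlgebra.Projectivization

/-- The points of the projective plane `PG(2, K)`. -/
abbrev PGPlane (K : Type*) [Field K] : Type _ := ℙ K (Fin 3 → K)

/-- The subline of the line `⟨u, w⟩` coordinatised by the subfield `F` of `K` in the basis `u, w`:
the points `⟨a u + b w⟩` with `a, b ∈ F` not both zero. -/
def sublineOf (F : Type*) {K : Type*} [Field F] [Field K] [Algebra F K]
    (u w : Fin 3 → K) : Set (PGPlane K) :=
  {Q | ∃ a b : F, (a ≠ 0 ∨ b ≠ 0) ∧
    Q.submodule = Submodule.span K {algebraMap F K a • u + algebraMap F K b • w}}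

/-- The cone of `PG(2, K)` with vertex the point `V` and base the point set `B`:
the union of the lines `VQ`, with `Q ∈ B`. -/
def coneOver {K : Type*} [Field K] (V : PGPlane K) (B : Set (PGPlane K)) : Set (PGPlane K) :=
  {P | ∃ Q ∈ B, P.submodule ≤ V.submodule ⊔ Q.submodule}

/-- Degenerate Hermitian curve (of rank 2) of `PG(2, K)`, where `K` is a quadratic extension of
the finite field `F`: a cone having as vertex a point `V` and as base a Baer subline of a line
not passing through `V`. -/
def IsDegenerateHermitianCurve (F : Type*) {K : Type*} [Field F] [Field K] [Algebra F K]
    (H : Set (PGPlane K)) : Prop :=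
  ∃ (V : PGPlane K) (u w : Fin 3 → K),
    LinearIndependent K ![u, w] ∧
    ¬ V.submodule ≤ Submodule.span K {u, w} ∧
    H = coneOver V (sublineOf F u w)

theorem ne_zero_of_apply_eq_one {K : Type*} [Field K] {v : Fin 3 → K} (i : Fin 3)
    (h : v i = 1) : v ≠ 0 := by
  rintro rfl
  simp at h

/-- The point of `PG(2, K)` with homogeneous coordinates `v`, where the `i`-th entry of `v`
is `1`. -/
def pointOf {K : Type*} [Field K] (v : Fin 3 → K) (i : Fin 3) (h : v i = 1) : PGPlane K :=
  Projectivization.mk K v (ne_zero_of_apply_eq_one i h)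

/-- The frame `(1,0,0), (0,1,0), (0,0,1), (1,1,1)`. -/
def framePoints (K : Type*) [Field K] : Set (PGPlane K) :=
  {pointOf ![1, 0, 0] 0 rfl, pointOf ![0, 1, 0] 1 rfl, pointOf ![0, 0, 1] 2 rfl,
    pointOf ![1, 1, 1] 0 rfl}

/-- The orbit of `(1, x, y)` under the cyclic permutations of the coordinates. -/
def cyclicOrbit {K : Type*} [Field K] (x y : K) : Set (PGPlane K) :=
  {pointOf ![1, x, y] 0 rfl, pointOf ![y, 1, x] 1 rfl, pointOf ![x, y, 1] 2 rfl}

/-- The set `P_{x, ξ}`: the frame together with the orbit of `(1, x, ξ x)`. -/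
def pointSet {F K : Type*} [Field F] [Field K] [Algebra F K] (x : F) (ξ : K) :
    Set (PGPlane K) :=
  framePoints K ∪ cyclicOrbit (algebraMap F K x) (ξ * algebraMap F K x)

/-! Let `σ` be the conjugation of GF(q²) over GF(q). If `f`, `g` are coordinates of the plane modulo
the vertex, the points of the cone satisfy `f σ(g) = g σ(f)`: they are isotropic for a nonzero
degenerate skew-hermitian form. The points `(1,0,0)`, `(0,1,0)`, `(0,0,1)` kill its diagonal,
leaving entries `a`, `b`, `c`, and degeneracy says that `abc` is fixed by `σ`.

The other four points give GF(q)-linear conditions on `(a, b, c)`. Their solutions form a plane with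
parameters `l`, `m` in GF(q), on which `abc - σ(abc)` is, up to a nonzero factor, a binary cubic
`A(l³ + m³) + B l²m - (3A + B) l m²`, with `A`, `B` depending on `x` and on the trace `τ` and norm
`ν` of `ξ`. If this cubic has no nontrivial zero, the form vanishes, a contradiction
(`eq_zero_of_degenerate_form`).

It remains to realise an anisotropic cubic. Counting gives an `n` for which `A = 1`, `B = n` is
anisotropic, and `exists_isGoodParameter` solves `B = nA` with `A ≠ 0` and `r² - τr + ν`
irreducible, so that `ξ` exists. Odd characteristic takes `x = -1`; characteristic two uses an
Artin–Schreier argument. -/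

theorem exists_notMem_of_card_lt {F : Type*} [Finite F] (s : Finset F) (h : s.card < Nat.card F) :
    ∃ x, x ∉ s := by
  have := Fintype.ofFinite F
  rw [Nat.card_eq_fintype_card, ← Finset.card_univ] at h
  obtain ⟨x, -, hx⟩ := Finset.exists_mem_notMem_of_card_lt_card h
  exact ⟨x, hx⟩

/-! ### The anisotropic cubic. -/

/-- Over a finite field some cubic `l³ + n l² m - (n + 3) l m² + m³` is anisotropic. -/
theorem exists_anisotropic_cubic (F : Type*) [Field F] [Finite F] :
    ∃ n : F, ∀ l m : F, l ≠ 0 ∨ m ≠ 0 →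
      l ^ 3 + n * l ^ 2 * m - (n + 3) * l * m ^ 2 + m ^ 3 ≠ 0 := by
  -- For `t ≠ 0, 1`, the cubic vanishes at `(t, 1)` exactly when `n = g t`. Division by zero gives
  -- `g 0 = g 1 = 0`, so `g` is not injective, hence misses some `n`.
  let g : F → F := fun t => -(t ^ 3 - 3 * t + 1) / (t ^ 2 - t)
  have hg : ¬ Function.Surjective g := by
    rw [← Finite.injective_iff_surjective]
    intro h
    exact zero_ne_one (h (show g 0 = g 1 by simp [g]))
  simp only [Function.Surjective, not_forall] at hg
  obtain ⟨n, hn⟩ := hg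
  refine ⟨n, fun l m hlm h => ?_⟩
  by_cases hm : m = 0
  · subst hm
    simp_all
  by_cases hl : l = 0
  · subst hl
    simp_all
  by_cases hd : l - m = 0
  · obtain rfl : l = m := sub_eq_zero.mp hd
    exact pow_ne_zero 3 hl (by linear_combination -h)
  refine hn ⟨l / m, ?_⟩
  have h1 : (l / m) ^ 2 - l / m ≠ 0 := by
    have : (l / m) ^ 2 - l / m = l * (l - m) / m ^ 2 := by field_simp
    rw [this]
    positivity
  simp only [g]
  rw [div_eq_iff h1]
  field_simp
  linear_combination -h

/-- The discriminant of the cubic is the square of this quantity. Were it zero, there would be a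
rational multiple root: `(-n : 3)`, or `(1 : -1)` in characteristic 3. -/
theorem sq_add_ne_zero_of_anisotropic {F : Type*} [Field F] {n : F}
    (hn : ∀ l m : F, l ≠ 0 ∨ m ≠ 0 →
      l ^ 3 + n * l ^ 2 * m - (n + 3) * l * m ^ 2 + m ^ 3 ≠ 0) :
    n ^ 2 + 3 * n + 9 ≠ 0 := by
  intro h
  by_cases h3 : (3 : F) = 0
  · have h0 : n = 0 := by
      have : n ^ 2 = 0 := by linear_combination h - (n + 3) * h3
      simpa using this
    exact hn 1 (-1) (by simp) (by rw [h0]; linear_combination (-1 : F) * h3)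
  · exact hn (-n) 3 (Or.inr h3) (by linear_combination (2 * n + 3) * h)

/-! ### Good parameters in odd characteristic. -/

/-- The conditions on `x`, the trace `τ` and the norm `ν` of `ξ` that keep `P_{x, ξ}` off the
degenerate Hermitian curves. -/
structure IsGoodParameter {F : Type*} [Field F] (n x τ ν : F) : Prop where
  ne_zero : x ≠ 0
  ne_one : x ≠ 1
  no_root : ∀ r : F, r ^ 2 - τ * r + ν ≠ 0
  trace_ne : (x + 1) * τ ≠ 1
  lead_ne_zero : 1 + x + (x + x ^ 2) * ν - (1 + x ^ 2) * τ ≠ 0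
  second_eq : (x ^ 3 - 1) * (τ ^ 2 - ν) - 3 * (x - τ + x ^ 2 * ν) =
    n * (1 + x + (x + x ^ 2) * ν - (1 + x ^ 2) * τ)

/-- At `x = -1` the leading coefficient is `-2τ`, and `second_eq` is linear in `ν` with this
solution. The hypothesis `hr` says that the discriminant `τ² - 4ν` is a nonsquare. -/
theorem isGoodParameter_neg_one {F : Type*} [Field F] {n τ : F} (h2 : (2 : F) ≠ 0) (hτ : τ ≠ 0)
    (hr : ∀ r : F, r ^ 2 ≠ 9 * τ ^ 2 - (8 * n + 12) * τ - 12) :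
    IsGoodParameter n (-1) τ (2 * n * τ - 2 * τ ^ 2 + 3 * τ + 3) where
  ne_zero := by simp
  ne_one h := h2 (by linear_combination -h)
  no_root r h := hr (2 * r - τ) (by linear_combination 4 * h)
  trace_ne := by simp
  lead_ne_zero h := mul_ne_zero h2 hτ (by linear_combination -h)
  second_eq := by ring

theorem exists_isGoodParameter_of_two_ne_zero {F : Type*} [Field F] [Finite F] {n : F}
    (h2 : (2 : F) ≠ 0) (hc2 : Nat.card F ≠ 2) (hc4 : Nat.card F ≠ 4)
    (hn : n ^ 2 + 3 * n + 9 ≠ 0) : ∃ x τ ν : F, IsGoodParameter n x τ ν := by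
  by_cases h3 : (3 : F) = 0
  · have hn0 : n ≠ 0 := by
      rintro rfl
      exact hn (by linear_combination 3 * h3)
    have hchar : ringChar F ≠ 2 := by
      intro h
      exact h2 (by exact_mod_cast (ringChar.spec F 2).mpr h.dvd)
    obtain ⟨g, hg⟩ := FiniteField.exists_nonsquare hchar
    have hg0 : g ≠ 0 := by
      rintro rfl
      exact hg (IsSquare.zero)
    -- In characteristic 3 the discriminant reduces to `nτ`, which is made equal to the nonsquare
    -- `g`.
    refine ⟨_, g / n, _, isGoodParameter_neg_one h2 (div_ne_zero hg0 hn0) fun r h => ?_⟩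
    have hgn : n * (g / n) = g := by field_simp
    refine hg ⟨r, ?_⟩
    linear_combination -h - hgn + ((3 * n + 4) * (g / n) - 3 * (g / n) ^ 2 + 4) * h3
  · have hc : 3 < Nat.card F := by
      have h1 : 1 < Nat.card F := Finite.one_lt_card
      have h3' : Nat.card F ≠ 3 := by
        intro h
        have := Fintype.ofFinite F
        have := Nat.cast_card_eq_zero F
        rw [← Nat.card_eq_fintype_card, h] at this
        exact h3 (by exact_mod_cast this)
      omega
    -- Completing the square turns `r² = 9τ² - (8n + 12)τ - 12` into the hyperbola `u² - r² = d`,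
    -- with `u = 3τ - (4n + 6)/3`.
    set d := 16 * (n ^ 2 + 3 * n + 9) / 9 with hd
    have h9 : (9 : F) ≠ 0 := by
      have : (9 : F) = 3 * 3 := by norm_num
      rw [this]
      exact mul_ne_zero h3 h3
    have hd0 : d ≠ 0 := by
      have : (16 : F) = 2 ^ 4 := by norm_num
      rw [hd, this]
      positivity
    have hd9 : 9 * d = 16 * (n ^ 2 + 3 * n + 9) := by rw [hd]; field_simp
    by_contra hcon
    classical
    -- `φ m` is the `τ` of the point of the hyperbola with `u - r = m`; the value at `0` accounts
    -- for `τ = 0`. If no `τ` works, `φ` is surjective, hence injective, although `φ m = φ (d / m)`.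
    let φ : F → F := fun m => if m = 0 then 0 else ((m + d / m) / 2 + (4 * n + 6) / 3) / 3
    have hsurj : Function.Surjective φ := by
      intro τ
      by_cases hτ : τ = 0
      · exact ⟨0, by simp [φ, hτ]⟩
      have : ∃ r : F, r ^ 2 = 9 * τ ^ 2 - (8 * n + 12) * τ - 12 := by
        by_contra h
        push Not at h
        exact hcon ⟨_, _, _, isGoodParameter_neg_one h2 hτ h⟩
      obtain ⟨r, hr⟩ := this
      set u := 3 * τ - (4 * n + 6) / 3 with hu
      have hu3 : 3 * u = 9 * τ - (4 * n + 6) := by rw [hu]; field_simp; ring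
      have hprod : (u - r) * (u + r) = d := by
        refine mul_left_cancel₀ h9 ?_
        rw [hd9]
        linear_combination (3 * u + (9 * τ - (4 * n + 6))) * hu3 - 9 * hr
      have hur : u - r ≠ 0 := left_ne_zero_of_mul (hprod ▸ hd0)
      refine ⟨u - r, ?_⟩
      simp only [φ, hur, if_false]
      have : d / (u - r) = u + r := by
        rw [div_eq_iff hur, ← hprod, mul_comm]
      rw [this, hu]
      field_simp
      ring
    have hinj := Finite.injective_iff_surjective.mpr hsurj
    have hm : ∀ m : F, m ≠ 0 → m ^ 2 = d := by
      intro m hm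
      have hdm : d / m ≠ 0 := div_ne_zero hd0 hm
      have : φ m = φ (d / m) := by
        simp only [φ, hm, hdm, if_false]
        rw [div_div_cancel₀ hd0, add_comm m]
      have := hinj this
      rw [eq_div_iff hm] at this
      rw [sq, this]
    obtain ⟨m, hm'⟩ := exists_notMem_of_card_lt ({0, 1, -1} : Finset F)
      (Finset.card_le_three.trans_lt hc)
    simp only [Finset.mem_insert, Finset.mem_singleton, not_or] at hm'
    have h1 := hm 1 one_ne_zero
    have := hm m hm'.1
    rw [← h1, sq_eq_sq_iff_eq_or_eq_neg] at this
    tauto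

/-! ### Good parameters in characteristic two. -/

theorem six_lt_card_of_two_eq_zero {F : Type*} [Field F] [Finite F] (h2 : (2 : F) = 0)
    (hc2 : Nat.card F ≠ 2) (hc4 : Nat.card F ≠ 4) : 6 < Nat.card F := by
  have := Fintype.ofFinite F
  have : CharP F 2 := CharTwo.of_one_ne_zero_of_two_eq_zero one_ne_zero h2
  obtain ⟨k, -, hk⟩ := FiniteField.card F 2
  rw [Nat.card_eq_fintype_card] at *
  have hk0 : (k : ℕ) ≠ 0 := k.ne_zero
  have hk3 : 3 ≤ (k : ℕ) := by
    by_contra h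
    have : (k : ℕ) = 1 ∨ (k : ℕ) = 2 := by omega
    rcases this with h | h <;> simp [h] at hk <;> omega
  rw [hk]
  calc 6 < 2 ^ 3 := by norm_num
    _ ≤ 2 ^ (k : ℕ) := Nat.pow_le_pow_right (by norm_num) hk3

/-- An Artin–Schreier argument: in characteristic two, if `β ^ 2 ≠ γ`, then some value of
`α + β y + γ y ^ 2` outside three given arguments is not of the form `z ^ 2 + z`. -/
theorem exists_quadratic_ne_sq_add_self {F : Type*} [Field F] [Finite F] (h2 : (2 : F) = 0)
    (hc : 6 < Nat.card F) {α β γ : F} (hβ : β ^ 2 ≠ γ) (e₁ e₂ e₃ : F) :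
    ∃ y, y ≠ e₁ ∧ y ≠ e₂ ∧ y ≠ e₃ ∧ ∀ z, z ^ 2 + z ≠ α + β * y + γ * y ^ 2 := by
  classical
  by_contra! hcon
  obtain ⟨k, hk⟩ := FiniteField.isSquare_of_char_two
    (ringChar.eq_iff.mpr (CharTwo.of_one_ne_zero_of_two_eq_zero one_ne_zero h2)) γ
  have hβk : β + k ≠ 0 := by
    intro h
    refine hβ ?_
    linear_combination (β - k) * h - hk
  have hsurj : Function.Surjective fun z : F => z ^ 2 + z := by
    intro w
    obtain ⟨z, hz⟩ : ∃ z, (β + k) * z = w := ⟨w / (β + k), by field_simp⟩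
    -- Both `y` and `y + z` must avoid the three exceptions. The values there differ by `βz + k²z² =
    -- (β + k)z + ((kz)² + kz)`, so `w = (β + k)z` is itself of the form `s² + s`.
    obtain ⟨y, hy⟩ := exists_notMem_of_card_lt
      ({e₁, e₂, e₃, e₁ - z, e₂ - z, e₃ - z} : Finset F) (Finset.card_le_six.trans_lt hc)
    simp only [Finset.mem_insert, Finset.mem_singleton, not_or, eq_sub_iff_add_eq] at hy
    obtain ⟨r, hr⟩ := hcon y hy.1 hy.2.1 hy.2.2.1
    obtain ⟨t, ht⟩ := hcon (y + z) hy.2.2.2.1 hy.2.2.2.2.1 hy.2.2.2.2.2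
    exact ⟨r + t + k * z, by grind⟩
  have hinj := Finite.injective_iff_surjective.mpr hsurj
  refine one_ne_zero (hinj (a₁ := (1 : F)) (a₂ := 0) ?_)
  linear_combination h2

theorem second_eq_of_two_eq_zero {R : Type*} [CommRing R] (h2 : (2 : R) = 0) {n x τ ν : R}
    (h : ν * (x ^ 3 + (n + 1) * x ^ 2 + n * x + 1) =
      (x ^ 3 + 1) * τ ^ 2 + τ + x + n * (1 + x) * (1 + (1 + x) * τ)) :
    (x ^ 3 - 1) * (τ ^ 2 - ν) - 3 * (x - τ + x ^ 2 * ν) =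
      n * (1 + x + (x + x ^ 2) * ν - (1 + x ^ 2) * τ) := by
  grind

/-- If the leading coefficient vanished, `second_eq` would have both sides zero; eliminating `ν`
leaves only finitely many `τ` to avoid. -/
theorem eliminate_norm_of_two_eq_zero {R : Type*} [CommRing R] (h2 : (2 : R) = 0) {x τ ν : R}
    (h : (x ^ 3 - 1) * (τ ^ 2 - ν) - 3 * (x - τ + x ^ 2 * ν) = 0)
    (h1 : 1 + x * ν + (1 + x) * τ = 0) :
    (x ^ 2 + x + 1) * (((x + 1) * τ + 1) * (x * τ + (x + 1))) = 0 := by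
  grind

theorem exists_isGoodParameter_of_two_eq_zero {F : Type*} [Field F] [Finite F] {n : F}
    (h2 : (2 : F) = 0) (hc : 6 < Nat.card F)
    (hn : ∀ l m : F, l ≠ 0 ∨ m ≠ 0 →
      l ^ 3 + n * l ^ 2 * m - (n + 3) * l * m ^ 2 + m ^ 3 ≠ 0) :
    ∃ x τ ν : F, IsGoodParameter n x τ ν := by
  classical
  obtain ⟨x, hx0, hx3⟩ : ∃ x : F, x ≠ 0 ∧ x ^ 3 ≠ 1 := by
    obtain ⟨x, hx⟩ := exists_notMem_of_card_lt
      (insert 0 (Polynomial.nthRootsFinset 3 (1 : F)))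
      (((Finset.card_insert_le _ _).trans (Nat.succ_le_succ
        ((Multiset.toFinset_card_le _).trans (Polynomial.card_nthRoots 3 1)))).trans_lt
          (by omega))
    rw [Finset.mem_insert, not_or, Polynomial.mem_nthRootsFinset (by norm_num)] at hx
    exact ⟨x, hx⟩
  have hx1 : x ≠ 1 := by
    rintro rfl
    simp at hx3
  have hx1' : x + 1 ≠ 0 := fun h => hx1 (by linear_combination h - h2)
  have hx31 : x ^ 3 + 1 ≠ 0 := fun h => hx3 (by linear_combination h - h2)
  have hn2 : n ^ 2 + n + 1 ≠ 0 := fun h =>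
    sq_add_ne_zero_of_anisotropic hn (by linear_combination h + (n + 4) * h2)
  obtain ⟨D, hD⟩ : ∃ D, D = x ^ 3 + (n + 1) * x ^ 2 + n * x + 1 := ⟨_, rfl⟩
  -- In characteristic two, `D` is the anisotropic cubic at `(1, x)`.
  have hD0 : D ≠ 0 := fun h => hn 1 x (by simp)
    (by linear_combination h - hD - ((n + 2) * x ^ 2) * h2)
  have hβ : ((1 + n * (1 + x ^ 2)) / D) ^ 2 ≠ (x + n * (1 + x)) / D := by
    intro h
    field_simp at h
    refine mul_ne_zero (mul_ne_zero hn2 hx1') hx31 ?_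
    grind
  -- Here `y = 1/τ`. Putting `z = r y` turns `r² + τr + ν = 0` into `z² + z = νy²`, whose right side
  -- is quadratic in `y`. The exceptions are `0`, the value with `(x + 1)τ = 1`, and the remaining
  -- value at which the leading coefficient could vanish.
  obtain ⟨y, hy0, hy1, hy2, hy⟩ := exists_quadratic_ne_sq_add_self h2 hc
    (α := (x ^ 3 + 1) / D) hβ 0 (x + 1) (x / (x + 1))
  obtain ⟨τ, hτ⟩ : ∃ τ, τ = y⁻¹ := ⟨_, rfl⟩
  have hτy : τ * y = 1 := by rw [hτ]; field_simp
  obtain ⟨ν, hν⟩ : ∃ ν, ν = ((x ^ 3 + 1) * τ ^ 2 + τ + x + n * (1 + x) * (1 + (1 + x) * τ)) / D :=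
    ⟨_, rfl⟩
  have hνD : ν * D = (x ^ 3 + 1) * τ ^ 2 + τ + x + n * (1 + x) * (1 + (1 + x) * τ) := by
    rw [hν]; field_simp
  have hsec : (x ^ 3 - 1) * (τ ^ 2 - ν) - 3 * (x - τ + x ^ 2 * ν) =
      n * (1 + x + (x + x ^ 2) * ν - (1 + x ^ 2) * τ) :=
    second_eq_of_two_eq_zero h2 (hD ▸ hνD)
  refine ⟨x, τ, ν, hx0, hx1, fun r hr => hy (r * y) ?_, fun h => hy1 ?_, fun h => ?_, hsec⟩
  · have : (x ^ 3 + 1) / D + (1 + n * (1 + x ^ 2)) / D * y + (x + n * (1 + x)) / D * y ^ 2 =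
      ν * y ^ 2 := by
      field_simp
      linear_combination -y ^ 2 * hνD - (x ^ 3 + 1) * (τ * y + 1) * hτy -
        y * (1 + n * (1 + x) ^ 2) * hτy - n * x * y * h2
    rw [this]
    linear_combination y ^ 2 * hr + r * y * hτy - (ν * y ^ 2) * h2 + r * y * h2
  · linear_combination (x + 1) * hτy - y * h
  · rw [h, mul_zero] at hsec
    have h1 : 1 + x * ν + (1 + x) * τ = 0 := by
      refine mul_left_cancel₀ hx1' ?_
      grind
    have h4 : x ^ 2 + x + 1 ≠ 0 := fun h => hx3 (by linear_combination (x - 1) * h)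
    have h5 : ((x + 1) * τ + 1) * (x * τ + (x + 1)) = 0 :=
      (mul_eq_zero.mp (eliminate_norm_of_two_eq_zero h2 hsec h1)).resolve_left h4
    rcases mul_eq_zero.mp h5 with h6 | h6
    · exact hy1 (by linear_combination (x + 1) * hτy - y * h6 + y * h2)
    · refine hy2 ?_
      rw [eq_div_iff hx1']
      linear_combination y * h6 - x * hτy - x * h2

theorem exists_isGoodParameter (F : Type*) [Field F] [Finite F] (hc2 : Nat.card F ≠ 2)
    (hc4 : Nat.card F ≠ 4) :
    ∃ n x τ ν : F, (∀ l m : F, l ≠ 0 ∨ m ≠ 0 →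
      l ^ 3 + n * l ^ 2 * m - (n + 3) * l * m ^ 2 + m ^ 3 ≠ 0) ∧ IsGoodParameter n x τ ν := by
  obtain ⟨n, hn⟩ := exists_anisotropic_cubic F
  refine ⟨n, ?_⟩
  by_cases h2 : (2 : F) = 0
  · obtain ⟨x, τ, ν, h⟩ := exists_isGoodParameter_of_two_eq_zero h2
      (six_lt_card_of_two_eq_zero h2 hc2 hc4) hn
    exact ⟨x, τ, ν, hn, h⟩
  · obtain ⟨x, τ, ν, h⟩ := exists_isGoodParameter_of_two_ne_zero h2 hc2 hc4
      (sq_add_ne_zero_of_anisotropic hn)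
    exact ⟨x, τ, ν, hn, h⟩

/-! ### The quadratic extension. -/

theorem exists_conjugation {F K : Type*} [Field F] [Finite F] [Field K] [Algebra F K]
    (hK : Module.finrank F K = 2) :
    ∃ σ : K ≃ₐ[F] K, (∀ z, σ (σ z) = z) ∧
      ∀ z, σ z = z → z ∈ Set.range (algebraMap F K) := by
  have : FiniteDimensional F K := Module.finite_of_finrank_eq_succ hK
  have : Finite K := Module.finite_of_finite F
  have hcard : Nat.card Gal(K/F) = 2 := (IsGalois.card_aut_eq_finrank F K).trans hK
  obtain ⟨σ, hσ, huniv⟩ := (Nat.card_eq_two_iff' (1 : Gal(K/F))).mp hcard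
  refine ⟨σ, fun z => ?_, fun z hz => ?_⟩
  · have h : σ ^ 2 = 1 := by
      rw [← hcard]
      exact pow_card_eq_one'
    rw [sq] at h
    exact DFunLike.congr_fun h z
  · rw [IsGalois.mem_range_algebraMap_iff_fixed]
    intro f
    by_cases hf : f = 1
    · rw [hf, AlgEquiv.one_apply]
    · rw [huniv f hf, hz]

theorem exists_root_of_quadratic {F K : Type*} [Field F] [Finite F] [Field K] [Algebra F K]
    (hK : Module.finrank F K = 2) {τ ν : F} (h : ∀ r : F, r ^ 2 - τ * r + ν ≠ 0) :
    ∃ ξ : K, ξ ^ 2 - algebraMap F K τ * ξ + algebraMap F K ν = 0 := by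
  have : FiniteDimensional F K := Module.finite_of_finrank_eq_succ hK
  have : Finite K := Module.finite_of_finite F
  let f : Polynomial F := Polynomial.X ^ 2 - Polynomial.C τ * Polynomial.X + Polynomial.C ν
  have hdeg : f.natDegree = 2 := by
    simp only [f]
    compute_degree!
  have hirr : Irreducible f := by
    rw [Polynomial.irreducible_iff_roots_eq_zero_of_degree_le_three hdeg.ge (by omega),
      Multiset.eq_zero_iff_forall_notMem]
    intro r hr
    exact h r (by simpa [f] using (Polynomial.mem_roots'.mp hr).2)
  have := Fact.mk hirr
  have hfin : Module.finrank F (AdjoinRoot f) = 2 := by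
    rw [(AdjoinRoot.powerBasis hirr.ne_zero).finrank, AdjoinRoot.powerBasis_dim, hdeg]
  obtain ⟨φ⟩ := FiniteField.nonempty_algHom_of_finrank_dvd (F := F) (K := AdjoinRoot f) (L := K)
    (by rw [hfin, hK])
  obtain ⟨ξ, hξ⟩ : ∃ ξ : K, Polynomial.aeval ξ f = 0 := ⟨φ (AdjoinRoot.root f), by
    rw [Polynomial.aeval_algHom_apply, AdjoinRoot.aeval_eq, AdjoinRoot.mk_self, map_zero]⟩
  exact ⟨ξ, by simpa [f] using hξ⟩

/-! ### Vanishing of the degenerate form. -/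

/-- The hermitian form with zero diagonal and entries `a`, `b`, `c` above it (up to cyclic order)
vanishes if it is degenerate and its curve contains `(1, 1, 1)` and the orbit of `(1, x, ξ x)`. -/
theorem eq_zero_of_degenerate_form {K : Type*} [Field K] (σ : K →+* K) {x ξ η τ ν a b c : K}
    (hη : σ ξ = η) (hη' : σ η = ξ) (hx : σ x = x) (hx1 : x ≠ 1) (hne : ξ ≠ η)
    (hτ : ξ + η = τ) (hν : ξ * η = ν) (htr : (x + 1) * τ ≠ 1)
    (hcubic : ∀ l m : K, σ l = l → σ m = m → (l ≠ 0 ∨ m ≠ 0) →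
      (1 + x + (x + x ^ 2) * ν - (1 + x ^ 2) * τ) * (l ^ 3 + m ^ 3) +
      ((x ^ 3 - 1) * (τ ^ 2 - ν) - 3 * (x - τ + x ^ 2 * ν)) * l ^ 2 * m -
      (3 * (1 + x + (x + x ^ 2) * ν - (1 + x ^ 2) * τ) +
      ((x ^ 3 - 1) * (τ ^ 2 - ν) - 3 * (x - τ + x ^ 2 * ν))) * l * m ^ 2 ≠ 0)
    (h0 : σ (a + b + c) = a + b + c)
    (h1 : σ (a + x * η * b + ξ * c) = a + x * η * b + ξ * c)
    (h2 : σ (ξ * a + b + x * η * c) = ξ * a + b + x * η * c)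
    (h3 : σ (x * η * a + ξ * b + c) = x * η * a + ξ * b + c)
    (habc : σ (a * b * c) = a * b * c) : a = 0 ∧ b = 0 ∧ c = 0 := by
  have hξη : ξ - η ≠ 0 := sub_ne_zero.mpr hne
  simp only [map_add, map_mul, hx, hη, hη'] at h0 h1 h2 h3 habc
  -- Adding `h1`, `h2`, `h3` shows that `(1 + xη + ξ)(a + b + c)` is fixed by `σ`; so is `a + b +
  -- c`, while the multiplier is not.
  have hs : a + b + c = 0 := by
    have : (a + b + c) * ((x - 1) * (ξ - η)) = 0 := by
      linear_combination h1 + h2 + h3 - (1 + x * ξ + η) * h0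
    exact (mul_eq_zero.mp this).resolve_right (mul_ne_zero (sub_ne_zero.mpr hx1) hξη)
  obtain rfl : c = -a - b := by linear_combination hs
  simp only [map_sub, map_neg] at h0 h1 h2 habc
  generalize hα : σ a = α at *
  generalize hβ : σ b = β at *
  have H1 : α * (1 - η) - β * (η - x * ξ) = a * (1 - ξ) - b * (ξ - x * η) := by
    linear_combination h1
  have H2 : α * (η - x * ξ) - β * (x * ξ - 1) = a * (ξ - x * η) - b * (x * η - 1) := by
    linear_combination h2
  -- `d` is the determinant of the system expressing `a`, `b` through the parameters `l`, `m`, which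
  -- are then found by Cramer's rule. If `d = 0`, then `d - σ d = 0` contradicts `htr`.
  obtain ⟨d, hd⟩ : ∃ d, d = (1 - η) * (x * ξ - 1) - (η - x * ξ) ^ 2 := ⟨_, rfl⟩
  have hσd : σ d = (1 - ξ) * (x * η - 1) - (ξ - x * η) ^ 2 := by
    simp [hd, hx, hη, hη']
  have hd0 : d ≠ 0 := by
    intro h
    rw [h, map_zero] at hσd
    rw [h] at hd
    have : ((x - 1) * (ξ - η)) * ((x + 1) * τ - 1) = 0 := by
      rw [← hτ]
      linear_combination hd - hσd
    exact mul_ne_zero (mul_ne_zero (sub_ne_zero.mpr hx1) hξη) (sub_ne_zero.mpr htr) this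
  have hσd0 : σ d ≠ 0 := (map_ne_zero σ).mpr hd0
  obtain ⟨l, hl⟩ : ∃ l, l = (a * (x * ξ - 1) - b * (η - x * ξ)) / d := ⟨_, rfl⟩
  obtain ⟨m, hm⟩ : ∃ m, m = ((1 - η) * b - (η - x * ξ) * a) / d := ⟨_, rfl⟩
  have hσl : σ l = l := by
    rw [hl, map_div₀, div_eq_div_iff hσd0 hd0, hσd, hd]
    simp only [map_sub, map_mul, map_one, hα, hβ, hx, hη, hη']
    linear_combination ((x * η - 1) * (x * ξ - 1) - (ξ - x * η) * (η - x * ξ)) * H1 +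
      ((1 - η) * (ξ - x * η) - (η - x * ξ) * (x * η - 1)) * H2
  have hσm : σ m = m := by
    rw [hm, map_div₀, div_eq_div_iff hσd0 hd0, hσd, hd]
    simp only [map_sub, map_mul, map_one, hα, hβ, hx, hη, hη']
    linear_combination ((1 - ξ) * (η - x * ξ) - (ξ - x * η) * (x * ξ - 1)) * H1 +
      ((η - x * ξ) * (ξ - x * η) - (1 - η) * (1 - ξ)) * H2
  have hld : l * d = a * (x * ξ - 1) - b * (η - x * ξ) := by rw [hl]; field_simp
  have hmd : m * d = (1 - η) * b - (η - x * ξ) * a := by rw [hm]; field_simp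
  have ha : a = l * (1 - η) + m * (η - x * ξ) := by
    refine mul_left_cancel₀ hd0 ?_
    linear_combination a * hd - (1 - η) * hld - (η - x * ξ) * hmd
  have hb : b = l * (η - x * ξ) + m * (x * ξ - 1) := by
    refine mul_left_cancel₀ hd0 ?_
    linear_combination b * hd - (η - x * ξ) * hld - (x * ξ - 1) * hmd
  have hα' : α = l * (1 - ξ) + m * (ξ - x * η) := by
    rw [← hα, ha]
    simp [hσl, hσm, hx, hη, hη']
  have hβ' : β = l * (ξ - x * η) + m * (x * η - 1) := by
    rw [← hβ, hb]
    simp [hσl, hσm, hx, hη, hη']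
  have hlm : l = 0 ∧ m = 0 := by
    by_contra hne
    refine hcubic l m hσl hσm (by tauto) ?_
    -- Up to sign, `abc - σ(abc)` is `ξ - η` times the cubic in `l`, `m`.
    refine mul_left_cancel₀ hξη ?_
    rw [hα', hβ', ha, hb] at habc
    rw [← hτ, ← hν]
    linear_combination -habc
  rw [hlm.1, hlm.2] at ha hb
  simp [ha, hb]

/-! ### Coordinates of cones and distinctness of the seven points. -/

/-- The cone with vertex `V` over a Baer subline, described by the coordinate functionals `f`, `g`
of the plane modulo `V` in the basis `u, w` of the base. -/
theorem exists_functionals_of_isDegenerateHermitianCurve {F K : Type*} [Field F] [Field K]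
    [Algebra F K] {H : Set (PGPlane K)} (hH : IsDegenerateHermitianCurve F H) :
    ∃ f g : (Fin 3 → K) →ₗ[K] K, (∃ u w, f u = 1 ∧ g u = 0 ∧ g w = 1 ∧ f w = 0) ∧
      ∀ p hp, Projectivization.mk K p hp ∈ H →
        ∃ (k : K) (a b : F), f p = k * algebraMap F K a ∧ g p = k * algebraMap F K b := by
  obtain ⟨V, u, w, huw, hV, rfl⟩ := hH
  have hV' : V.rep ∉ Submodule.span K (Set.range ![u, w]) := by
    rw [V.submodule_eq, Submodule.span_singleton_le_iff_mem] at hV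
    simpa [Matrix.range_cons, Matrix.range_empty, Set.pair_comm] using hV
  have hli : LinearIndependent K ![V.rep, u, w] := linearIndependent_finCons.mpr ⟨huw, hV'⟩
  let e := basisOfLinearIndependentOfCardEqFinrank hli (by simp)
  have he : ⇑e = ![V.rep, u, w] := coe_basisOfLinearIndependentOfCardEqFinrank _ _
  have h0 : e 0 = V.rep := by simp [he]
  have h1 : e 1 = u := by simp [he]
  have h2 : e 2 = w := by simp [he]
  refine ⟨e.coord 1, e.coord 2, ⟨u, w, ?_, ?_, ?_, ?_⟩, ?_⟩
  · simp [← h1]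
  · simp [← h1]
  · simp [← h2]
  · simp [← h2]
  rintro p hp ⟨Q, ⟨a, b, -, hQ⟩, hle⟩
  rw [Projectivization.submodule_mk, hQ, V.submodule_eq, Submodule.span_singleton_le_iff_mem,
    Submodule.mem_sup] at hle
  obtain ⟨y, hy, z, hz, rfl⟩ := hle
  obtain ⟨r, rfl⟩ := Submodule.mem_span_singleton.mp hy
  obtain ⟨k, rfl⟩ := Submodule.mem_span_singleton.mp hz
  refine ⟨k, a, b, ?_, ?_⟩
  · simp [← h0, ← h1, ← h2, -algebraMap_smul]
  · simp [← h0, ← h1, ← h2, -algebraMap_smul]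

theorem LinearMap.apply_eq_fin_three {K : Type*} [Field K] (f : (Fin 3 → K) →ₗ[K] K)
    (p : Fin 3 → K) : f p = p 0 * f ![1, 0, 0] + p 1 * f ![0, 1, 0] + p 2 * f ![0, 0, 1] := by
  have : p = p 0 • ![1, 0, 0] + p 1 • ![0, 1, 0] + p 2 • ![0, 0, 1] := by
    ext i
    fin_cases i <;> simp
  conv_lhs => rw [this]
  simp only [map_add, map_smul, smul_eq_mul]

theorem eq_of_pointOf_eq {K : Type*} [Field K] {v w : Fin 3 → K} {i j : Fin 3} {hv : v i = 1}
    {hw : w j = 1} (h : pointOf v i hv = pointOf w j hw) (k l : Fin 3) :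
    v k * w l = v l * w k := by
  obtain ⟨c, rfl⟩ := (Projectivization.mk_eq_mk_iff' K _ _ _ _).mp h
  simp only [Pi.smul_apply, smul_eq_mul]
  ring

theorem ncard_pointSet {F K : Type*} [Field F] [Field K] [Algebra F K] {x : F} {ξ : K}
    (hx0 : x ≠ 0) (hx1 : x ≠ 1) (hξ : ξ ∉ Set.range (algebraMap F K)) :
    (pointSet x ξ).ncard = 7 := by
  have hX0 : algebraMap F K x ≠ 0 := by simpa using hx0
  have hX1 : algebraMap F K x ≠ 1 := by simpa using hx1
  have hξ0 : ξ ≠ 0 := fun h => hξ ⟨0, by simp [h]⟩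
  -- This coincidence and the next would force `ξ = x⁻²` and `ξ = x`, both in the subfield.
  have hξx2 : algebraMap F K x * (ξ * algebraMap F K x) ≠ 1 := fun h => hξ ⟨(x * x)⁻¹, by
    rw [map_inv₀, map_mul]
    field_simp
    linear_combination -h⟩
  have hξ2 : ξ * algebraMap F K x ≠ algebraMap F K x * algebraMap F K x := fun h =>
    hξ ⟨x, (mul_right_cancel₀ hX0 h).symm⟩
  generalize hX : algebraMap F K x = X at *
  generalize hY : ξ * X = Y at *
  have hY0 : Y ≠ 0 := hY ▸ mul_ne_zero hξ0 hX0
  have := hX0.symm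
  have := hX1.symm
  have := hξ2.symm
  have := hξx2.symm
  have key : ∀ {v w : Fin 3 → K} {i j : Fin 3} {hv : v i = 1} {hw : w j = 1} (k l : Fin 3),
      v k * w l ≠ v l * w k → pointOf v i hv ≠ pointOf w j hw :=
    fun k l h h' => h (eq_of_pointOf_eq h' k l)
  rw [pointSet, framePoints, cyclicOrbit, hX, hY, Set.insert_union, Set.insert_union,
    Set.insert_union, Set.singleton_union]
  iterate 6 rw [Set.ncard_insert_of_notMem]
  · rw [Set.ncard_singleton]
  all_goals
    simp only [Set.mem_insert_iff, Set.mem_singleton_iff, not_or]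
    and_intros
  all_goals
    first
    | refine key 0 1 ?_; simp [*]; done
    | refine key 0 2 ?_; simp [*]; done
    | refine key 1 2 ?_; simp [*]

/-! ### Conclusion. -/

theorem mainTheorem5 (F K : Type*) [Field F] [Finite F] [Field K] [Algebra F K]
    (hK : Module.finrank F K = 2) (h2 : Nat.card F ≠ 2) (h4 : Nat.card F ≠ 4) :
    ∃ (x : F) (ξ : K), x ≠ 0 ∧ x ≠ 1 ∧ ξ ∉ Set.range (algebraMap F K) ∧
      (pointSet x ξ).ncard = 7 ∧
      ∀ H : Set (PGPlane K), IsDegenerateHermitianCurve F H → ¬ pointSet x ξ ⊆ H := by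
  obtain ⟨n, x, τ, ν, hn, hgood⟩ := exists_isGoodParameter F h2 h4
  obtain ⟨σ, hσσ, hfix⟩ := exists_conjugation hK
  obtain ⟨ξ, hroot⟩ := exists_root_of_quadratic hK hgood.no_root
  have hξ : ξ ∉ Set.range (algebraMap F K) := by
    rintro ⟨r, rfl⟩
    refine hgood.no_root r ((algebraMap F K).injective ?_)
    simpa using hroot
  obtain ⟨η, hη⟩ : ∃ η, σ ξ = η := ⟨_, rfl⟩
  have hη' : σ η = ξ := by rw [← hη, hσσ]
  have hne : ξ ≠ η := fun h => hξ (hfix ξ (hη.trans h.symm))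
  have hrootη : η ^ 2 - algebraMap F K τ * η + algebraMap F K ν = 0 := by
    simpa [hη] using congrArg σ hroot
  have hτ : ξ + η = algebraMap F K τ := by
    refine mul_left_cancel₀ (sub_ne_zero.mpr hne) ?_
    linear_combination hroot - hrootη
  have hν : ξ * η = algebraMap F K ν := by
    linear_combination ξ * hτ - hroot
  refine ⟨x, ξ, hgood.ne_zero, hgood.ne_one, hξ, ncard_pointSet hgood.ne_zero hgood.ne_one hξ,
    fun H hH hsub => ?_⟩
  obtain ⟨f, g, ⟨u, w, hfu, hgu, hgw, hfw⟩, hfg⟩ :=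
    exists_functionals_of_isDegenerateHermitianCurve hH
  -- On the cone, `f` and `g` are a common multiple of elements of the subfield, so the
  -- skew-hermitian form `f σ(g) - g σ(f)` vanishes.
  have hmem : ∀ v i hv, pointOf v i hv ∈ pointSet x ξ → f v * σ (g v) = g v * σ (f v) := by
    intro v i hv hP
    obtain ⟨k, a, b, hf, hg⟩ := hfg v _ (hsub hP)
    simp only [hf, hg, map_mul, AlgEquiv.commutes]
    ring
  obtain ⟨X, hX⟩ : ∃ X, algebraMap F K x = X := ⟨_, rfl⟩
  have hσX : σ X = X := by rw [← hX, AlgEquiv.commutes]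
  have hX0 : X ≠ 0 := by simpa [← hX] using hgood.ne_zero
  have hX1 : X ≠ 1 := by simpa [← hX] using hgood.ne_one
  have e1 := hmem ![1, 0, 0] 0 rfl (by simp [pointSet, framePoints])
  have e2 := hmem ![0, 1, 0] 1 rfl (by simp [pointSet, framePoints])
  have e3 := hmem ![0, 0, 1] 2 rfl (by simp [pointSet, framePoints])
  have e4 := hmem ![1, 1, 1] 0 rfl (by simp [pointSet, framePoints])
  have e5 := hmem ![1, X, ξ * X] 0 rfl (by simp [pointSet, cyclicOrbit, hX])
  have e6 := hmem ![ξ * X, 1, X] 1 rfl (by simp [pointSet, cyclicOrbit, hX])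
  have e7 := hmem ![X, ξ * X, 1] 2 rfl (by simp [pointSet, cyclicOrbit, hX])
  -- The form is not zero: its value at `(u, w)` is `1`.
  have hpol : f u * σ (g w) ≠ g u * σ (f w) := by simp [hfu, hgu, hgw, hfw]
  rw [f.apply_eq_fin_three ![1, 1, 1], g.apply_eq_fin_three ![1, 1, 1]] at e4
  rw [f.apply_eq_fin_three ![1, X, _], g.apply_eq_fin_three ![1, X, _]] at e5
  rw [f.apply_eq_fin_three ![_, 1, X], g.apply_eq_fin_three ![_, 1, X]] at e6
  rw [f.apply_eq_fin_three ![X, _, 1], g.apply_eq_fin_three ![X, _, 1]] at e7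
  rw [f.apply_eq_fin_three u, g.apply_eq_fin_three u, f.apply_eq_fin_three w,
    g.apply_eq_fin_three w] at hpol
  generalize f ![1, 0, 0] = f₁ at *
  generalize f ![0, 1, 0] = f₂ at *
  generalize f ![0, 0, 1] = f₃ at *
  generalize g ![1, 0, 0] = g₁ at *
  generalize g ![0, 1, 0] = g₂ at *
  generalize g ![0, 0, 1] = g₃ at *
  simp only [Matrix.cons_val, map_add, map_mul, map_one, hσX, hη] at e4 e5 e6 e7 hpol
  obtain ⟨ha, hb, hc⟩ := eq_zero_of_degenerate_form (σ : K →+* K) (x := X) (ξ := ξ) (η := η)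
    (τ := algebraMap F K τ) (ν := algebraMap F K ν)
    (a := f₁ * σ g₂ - g₁ * σ f₂) (b := f₂ * σ g₃ - g₂ * σ f₃) (c := f₃ * σ g₁ - g₃ * σ f₁)
    hη hη' hσX hX1 hne hτ hν
    (by
      rw [← hX, ← map_one (algebraMap F K), ← map_add, ← map_mul]
      exact (algebraMap F K).injective.ne hgood.trace_ne)
    (by
      intro l m hl hm hlm
      obtain ⟨l, rfl⟩ := hfix l hl
      obtain ⟨m, rfl⟩ := hfix m hm
      have := mul_ne_zero hgood.lead_ne_zero (hn l m (by simpa using hlm))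
      have hs := congrArg (algebraMap F K) hgood.second_eq
      rw [← map_ne_zero (algebraMap F K)] at this
      simp only [map_add, map_sub, map_mul, map_pow, map_one, map_ofNat, hX] at this hs
      rw [hs]
      intro h
      exact this (by linear_combination h))
    (by
      simp only [RingHom.coe_coe, map_add, map_sub, map_mul, hσσ]
      linear_combination e1 + e2 + e3 - e4)
    (by
      refine mul_left_cancel₀ hX0 ?_
      simp only [RingHom.coe_coe, map_add, map_sub, map_mul, hσσ, hσX, hη, hη']
      linear_combination e1 + X ^ 2 * e2 + X ^ 2 * ξ * η * e3 - e5)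
    (by
      refine mul_left_cancel₀ hX0 ?_
      simp only [RingHom.coe_coe, map_add, map_sub, map_mul, hσσ, hσX, hη, hη']
      linear_combination X ^ 2 * ξ * η * e1 + e2 + X ^ 2 * e3 - e6)
    (by
      refine mul_left_cancel₀ hX0 ?_
      simp only [RingHom.coe_coe, map_add, map_sub, map_mul, hσσ, hσX, hη, hη']
      linear_combination X ^ 2 * e1 + X ^ 2 * ξ * η * e2 + e3 - e7)
    (by
      simp only [RingHom.coe_coe, map_sub, map_mul, hσσ]
      -- The matrix `fᵢ σ(gⱼ) - gᵢ σ(fⱼ)` has rank at most two. With its diagonal zero, its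
      -- vanishing determinant reduces to `abc - σ(abc)`.
      linear_combination
        ((f₂ * σ g₂ - g₂ * σ f₂) * (f₃ * σ g₃ - g₃ * σ f₃) -
          (f₂ * σ g₃ - g₂ * σ f₃) * (f₃ * σ g₂ - g₃ * σ f₂)) * e1 -
        (f₁ * σ g₃ - g₁ * σ f₃) * (f₃ * σ g₁ - g₃ * σ f₁) * e2 -
        (f₁ * σ g₂ - g₁ * σ f₂) * (f₂ * σ g₁ - g₂ * σ f₁) * e3)
  have ha' := congrArg σ ha
  have hb' := congrArg σ hb
  have hc' := congrArg σ hc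
  simp only [map_sub, map_mul, hσσ, map_zero] at ha' hb' hc'
  refine hpol ?_
  linear_combination u 0 * σ (w 0) * e1 + u 1 * σ (w 1) * e2 + u 2 * σ (w 2) * e3 +
    u 0 * σ (w 1) * ha + u 1 * σ (w 2) * hb + u 2 * σ (w 0) * hc -
    u 1 * σ (w 0) * ha' - u 2 * σ (w 1) * hb' - u 0 * σ (w 2) * hc'
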